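/- Let $R$ be a commutative ring with identity. A submodule $F$ of an $R$-module $E$ is *pure* if the sequence $0\to F\to E\to E/F\to 0$ remains exact after tensoring with any $R$-module, and it is an *RD-submodule* if $rE\cap F=rF$ for every $r\in R$. A *pure-composition series* (respectively an *RD-composition series*) of an $R$-module $M$ is a finite chain $\{0\}=M_0\subset M_1\subset\dots\subset M_n=M$ of pure submodules (respectively RD-submodules) of $M$; its factors are the modules $M_i/M_{i-1}$, $1\le i\le n$. The following conditions are equivalent: 1. Every finitely generated $R$-module has a pure-composition series with cyclic factors. 2. Every finitely generated $R$-module has an RD-composition series with cyclic factors. Moreover, if $R$ satisfies one of these conditions, then $R$ is arithmetic, i.e. for every maximal ideal $P$ the ideals of the localization $R_P$ are totally ordered by inclusion, and $R$ is a Kaplansky ring (elementary divisor ring), i.e. every finitely presented $R$-module is isomorphic to a finite direct sum of modules of the form $R/Ra$ with $a\in R$. -/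

import Mathlib

open scoped Pointwise

universe u

/-- `F` is a pure submodule of `E`: the sequence `0 → F → E → E ⧸ F → 0` stays exact after
tensoring with any `R`-module. -/
def IsPureSubmodule {R : Type u} [CommRing R] {E : Type u} [AddCommGroup E] [Module R E]
    (F : Submodule R E) : Prop :=
  ∀ (N : Type u) [AddCommGroup N] [Module R N],
    Function.Injective (F.subtype.rTensor N) ∧
    Function.Exact (F.subtype.rTensor N) (F.mkQ.rTensor N) ∧
    Function.Surjective (F.mkQ.rTensor N)

/-- `F` is an RD-submodule (relatively divisible submodule) of `E`: `rE ∩ F = rF` for every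
`r ∈ R`. -/
def IsRDSubmodule {R : Type u} [CommRing R] {E : Type u} [AddCommGroup E] [Module R E]
    (F : Submodule R E) : Prop :=
  ∀ r : R, (r • (⊤ : Submodule R E)) ⊓ F = r • F

/-- `E` is a cyclic module: it is generated by one element. -/
def IsCyclicModule (R : Type u) [CommRing R] (E : Type u) [AddCommGroup E] [Module R E] : Prop :=
  ∃ x : E, Submodule.span R {x} = ⊤

/-- There is a finite chain `0 = M₀ ⊂ M₁ ⊂ ⋯ ⊂ Mₙ = M` of submodules of `M` that satisfy `P`,
all of whose factors `Mᵢ₊₁ ⧸ Mᵢ` are cyclic. -/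
def HasCyclicSeries {R : Type u} [CommRing R] {M : Type u} [AddCommGroup M] [Module R M]
    (P : Submodule R M → Prop) : Prop :=
  ∃ (n : ℕ) (c : Fin (n + 1) → Submodule R M),
    StrictMono c ∧ c 0 = ⊥ ∧ c (Fin.last n) = ⊤ ∧ (∀ i, P (c i)) ∧
    ∀ i : Fin n,
      IsCyclicModule R (↥(c i.succ) ⧸ (c i.castSucc).submoduleOf (c i.succ))

/-- Every finitely generated `R`-module has a pure-composition series with cyclic factors. -/
def HasPureCyclicSeriesProperty (R : Type u) [CommRing R] : Prop :=
  ∀ (M : Type u) [AddCommGroup M] [Module R M], Module.Finite R M →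
    HasCyclicSeries (fun F : Submodule R M => IsPureSubmodule F)

/-- Every finitely generated `R`-module has an RD-composition series with cyclic factors. -/
def HasRDCyclicSeriesProperty (R : Type u) [CommRing R] : Prop :=
  ∀ (M : Type u) [AddCommGroup M] [Module R M], Module.Finite R M →
    HasCyclicSeries (fun F : Submodule R M => IsRDSubmodule F)

/-- The submodules of `E` are totally ordered by inclusion. -/
def IsUniserial (R : Type u) [CommRing R] (E : Type u) [AddCommGroup E] [Module R E] : Prop :=
  ∀ A B : Submodule R E, A ≤ B ∨ B ≤ A

/-- A valuation ring, possibly with zero divisors: a ring that is uniserial as a module over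
itself. (Mathlib's `ValuationRing` is restricted to domains.) -/
def IsUniserialRing (R : Type u) [CommRing R] : Prop :=
  IsUniserial R R

/-- `R` is arithmetic: its localization at every maximal ideal is a valuation ring. -/
def IsArithmeticRing (R : Type u) [CommRing R] : Prop :=
  ∀ (P : Ideal R) [P.IsMaximal], IsUniserialRing (Localization.AtPrime P)

/-- `R` is a Kaplansky ring (elementary divisor ring): every finitely presented `R`-module is a
finite direct sum of cyclically presented modules `R ⧸ Ra`. -/
def IsKaplanskyRing (R : Type u) [CommRing R] : Prop :=
  ∀ (M : Type u) [AddCommGroup M] [Module R M], Module.FinitePresentation R M →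
    ∃ (n : ℕ) (a : Fin n → R), Nonempty (M ≃ₗ[R] ((i : Fin n) → R ⧸ Ideal.span {a i}))

/-!
Injectivity of `F ⊗ N → E ⊗ N` for `N = R ⧸ Ra` says precisely that `aE ∩ F = aF`, so purity
implies relative divisibility. As every module is a direct limit of finitely presented ones, the
converse holds over a Kaplansky ring. It remains to see that RD-composition series with cyclic
factors force `R` to be arithmetic and Kaplansky.

Let `a` and `b` be incomparable at a maximal ideal `P`, put `M = R² ⧸ R(a, b)`, and let `G` be an
RD-submodule of `M` such that the annihilator of `M ⧸ G` lies in `P`. Then the same holds for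
`G + Rz`. Indeed, let `s` satisfy `s e₁ ≡ α z` and `s e₂ ≡ β z` modulo `G`. Then `r = aα + bβ`
sends `z` into `G`, hence kills `z - f = x e₁ + y e₂` for some `f ∈ G`. As `a` and `b` are
incomparable, this forces `αx + βy ∈ P`, whereas `(s - αx - βy) s` annihilates `M ⧸ G`; so `s ∈ P`.
A series of RD-submodules with cyclic factors could therefore never reach `M`, and `R` is
arithmetic.

In such a series for a finitely generated ideal, local comparability makes each member principal,
so `R` is Bézout. In such a series for a finitely presented module, the last factor is of the form
`R ⧸ Ra`, and relative divisibility lifts its generator to an element killed by `a`. Thus the last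
factor splits off, and induction shows that `R` is a Kaplansky ring.
-/

section Tensor

open TensorProduct

variable {R M M' N : Type*} [CommRing R] [AddCommGroup M] [Module R M]
  [AddCommGroup M'] [Module R M'] [AddCommGroup N] [Module R N]

theorem lTensor_injective_of_forall_fg (f : M →ₗ[R] M')
    (h : ∀ P : Submodule R N, P.FG → Function.Injective (f.lTensor P)) :
    Function.Injective (f.lTensor N) := by
  rw [injective_iff_map_eq_zero]
  intro x hx
  obtain ⟨P, hP, t, rfl⟩ := exists_of_fg x
  have hft : (P.subtype.rTensor M') (f.lTensor P t) = 0 := by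
    rwa [← LinearMap.comp_apply, LinearMap.rTensor_comp_lTensor,
      ← LinearMap.lTensor_comp_rTensor]
  obtain ⟨Q, hPQ, hQ, hftQ⟩ := eq_zero_of_fg_of_subtype_eq_zero hP hft
  have htQ : (Submodule.inclusion hPQ).rTensor M t = 0 := by
    apply (injective_iff_map_eq_zero _).1 (h Q hQ)
    rwa [← LinearMap.comp_apply, LinearMap.lTensor_comp_rTensor,
      ← LinearMap.rTensor_comp_lTensor]
  rw [← Submodule.subtype_comp_inclusion P Q hPQ, LinearMap.rTensor_comp_apply, htQ, map_zero]

theorem lTensor_injective_of_forall_fg_quotient [Module.Finite R N] (f : M →ₗ[R] M')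
    (h : ∀ (n : ℕ) (K : Submodule R (Fin n → R)), K.FG →
      Function.Injective (f.lTensor ((Fin n → R) ⧸ K))) :
    Function.Injective (f.lTensor N) := by
  rw [injective_iff_map_eq_zero]
  intro x hx
  obtain ⟨n, p, hp⟩ := Module.Finite.exists_fin' R N
  obtain ⟨ξ, rfl⟩ := LinearMap.rTensor_surjective M hp x
  have hfξ : p.rTensor M' (f.lTensor _ ξ) = 0 := by
    rwa [← LinearMap.comp_apply, LinearMap.rTensor_comp_lTensor,
      ← LinearMap.lTensor_comp_rTensor]
  obtain ⟨κ, hκ⟩ := (rTensor_exact M' (LinearMap.exact_subtype_ker_map p) hp _).1 hfξ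
  obtain ⟨K, hK, κ₀, rfl⟩ := exists_of_fg κ
  let K' := K.map (LinearMap.ker p).subtype
  have hK' : K' ≤ LinearMap.ker p := Submodule.map_subtype_le _ _
  have hξ : K'.mkQ.rTensor M ξ = 0 := by
    apply (injective_iff_map_eq_zero _).1 (h n K' (hK.map _))
    have hzero : (K'.mkQ ∘ₗ (LinearMap.ker p).subtype) ∘ₗ K.subtype = 0 := by
      ext k : 1
      exact (Submodule.Quotient.mk_eq_zero K').2 (Submodule.mem_map_of_mem k.2)
    rw [← LinearMap.comp_apply, LinearMap.lTensor_comp_rTensor, ← LinearMap.rTensor_comp_lTensor,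
      LinearMap.comp_apply, ← hκ, ← LinearMap.rTensor_comp_apply, ← LinearMap.rTensor_comp_apply,
      hzero, LinearMap.rTensor_zero, LinearMap.zero_apply]
  rw [← Submodule.liftQ_mkQ K' p hK', LinearMap.rTensor_comp_apply, hξ, map_zero]

theorem rTensor_injective_of_forall_finitePresentation_quotient (f : M →ₗ[R] M')
    (h : ∀ (n : ℕ) (K : Submodule R (Fin n → R)), K.FG →
      Function.Injective (f.rTensor ((Fin n → R) ⧸ K))) :
    Function.Injective (f.rTensor N) := by
  rw [← LinearMap.lTensor_inj_iff_rTensor_inj]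
  refine lTensor_injective_of_forall_fg f fun P hP => ?_
  have : Module.Finite R P := .of_fg hP
  exact lTensor_injective_of_forall_fg_quotient f fun n K hK =>
    (LinearMap.lTensor_inj_iff_rTensor_inj _ f).2 (h n K hK)

theorem rTensor_pi_injective {ι : Type*} [Finite ι] {N : ι → Type*} [∀ i, AddCommGroup (N i)]
    [∀ i, Module R (N i)] (f : M →ₗ[R] M') (h : ∀ i, Function.Injective (f.rTensor (N i))) :
    Function.Injective (f.rTensor (∀ i, N i)) := by
  classical
  have := Fintype.ofFinite ι
  rw [injective_iff_map_eq_zero]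
  intro x hx
  have hproj (i : ι) : (LinearMap.proj i : (∀ i, N i) →ₗ[R] N i).lTensor M x = 0 := by
    apply (injective_iff_map_eq_zero _).1 (h i)
    rw [← LinearMap.comp_apply, LinearMap.rTensor_comp_lTensor, ← LinearMap.lTensor_comp_rTensor,
      LinearMap.comp_apply, hx, map_zero]
  apply (piRight R R M N).injective
  rw [map_zero]
  ext i
  rw [Pi.zero_apply, ← hproj i]
  clear hproj hx
  induction x with
  | zero => simp
  | tmul m n => simp
  | add x y hx hy => simp_all

theorem tmul_one_quotient_span_singleton_eq_zero_iff {a : R} {m : M} :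
    m ⊗ₜ[R] (1 : R ⧸ Ideal.span {a}) = 0 ↔ ∃ m', a • m' = m := by
  rw [← tensorQuotEquivQuotSMul_symm_mk, LinearEquiv.map_eq_zero_iff,
    Submodule.Quotient.mk_eq_zero, Submodule.ideal_span_singleton_smul,
    Submodule.mem_smul_pointwise_iff_exists]
  simp only [Submodule.mem_top, true_and]

theorem tmul_one_quotient_surjective (I : Ideal R) :
    Function.Surjective fun m : M => m ⊗ₜ[R] (1 : R ⧸ I) :=
  (tensorQuotEquivQuotSMul M I).symm.surjective.comp (Submodule.mkQ_surjective _)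

theorem rTensor_quotient_span_singleton_injective_iff {F : Submodule R M} {a : R} :
    Function.Injective (F.subtype.rTensor (R ⧸ Ideal.span {a})) ↔
      ∀ m, a • m ∈ F → ∃ f ∈ F, a • f = a • m := by
  rw [injective_iff_map_eq_zero]
  simp only [(tmul_one_quotient_surjective _).forall, LinearMap.rTensor_tmul,
    tmul_one_quotient_span_singleton_eq_zero_iff, Submodule.subtype_apply]
  constructor
  · intro h m hm
    obtain ⟨f, hf⟩ := h ⟨a • m, hm⟩ ⟨m, rfl⟩
    exact ⟨f, f.2, congrArg Subtype.val hf⟩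
  · rintro h ⟨_, hm⟩ ⟨m, rfl⟩
    obtain ⟨f, hf, hfm⟩ := h m hm
    exact ⟨⟨f, hf⟩, Subtype.ext hfm⟩

end Tensor

section Purity

variable {R : Type u} [CommRing R] {E : Type u} [AddCommGroup E] [Module R E] {F : Submodule R E}

theorem isRDSubmodule_iff_forall_exists_smul_eq :
    IsRDSubmodule F ↔ ∀ (r : R) (m : E), r • m ∈ F → ∃ f ∈ F, r • f = r • m := by
  refine forall_congr' fun r => ?_
  have hle : r • F ≤ r • ⊤ ⊓ F :=
    le_inf (Submodule.map_mono le_top) (Submodule.smul_le_self_of_tower r F)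
  rw [← hle.ge_iff_eq', SetLike.le_def]
  simp only [Submodule.mem_inf, Submodule.mem_smul_pointwise_iff_exists, Submodule.mem_top,
    true_and, and_imp, forall_exists_index, forall_apply_eq_imp_iff]

theorem isPureSubmodule_iff_forall_rTensor_injective :
    IsPureSubmodule F ↔ ∀ (N : Type u) [AddCommGroup N] [Module R N],
      Function.Injective (F.subtype.rTensor N) :=
  ⟨fun h N _ _ => (h N).1, fun h N _ _ =>
    ⟨h N, rTensor_exact N (LinearMap.exact_subtype_mkQ F) F.mkQ_surjective,
      LinearMap.rTensor_surjective N F.mkQ_surjective⟩⟩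

theorem isRDSubmodule_iff_forall_rTensor_injective :
    IsRDSubmodule F ↔ ∀ r : R, Function.Injective (F.subtype.rTensor (R ⧸ Ideal.span {r})) := by
  simp only [isRDSubmodule_iff_forall_exists_smul_eq,
    rTensor_quotient_span_singleton_injective_iff]

theorem IsPureSubmodule.isRDSubmodule (hF : IsPureSubmodule F) : IsRDSubmodule F :=
  isRDSubmodule_iff_forall_rTensor_injective.2 fun _ =>
    isPureSubmodule_iff_forall_rTensor_injective.1 hF _

theorem IsKaplanskyRing.isPureSubmodule_of_isRDSubmodule (hR : IsKaplanskyRing R)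
    (hF : IsRDSubmodule F) : IsPureSubmodule F := by
  rw [isPureSubmodule_iff_forall_rTensor_injective]
  rw [isRDSubmodule_iff_forall_rTensor_injective] at hF
  refine fun N _ _ => rTensor_injective_of_forall_finitePresentation_quotient _ fun n K hK => ?_
  obtain ⟨m, a, ⟨e⟩⟩ := hR ((Fin n → R) ⧸ K)
    (Module.finitePresentation_of_surjective K.mkQ K.mkQ_surjective (by rwa [K.ker_mkQ]))
  have hpi := rTensor_pi_injective F.subtype fun i => hF (a i)
  have hcomp : F.subtype.rTensor _ =
      (e.symm.lTensor E).toLinearMap ∘ₗ F.subtype.rTensor _ ∘ₗ (e.lTensor F).toLinearMap :=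
    TensorProduct.ext' fun f q => by simp
  rw [hcomp]
  exact (e.symm.lTensor E).injective.comp (hpi.comp (e.lTensor F).injective)

end Purity

section SpanSingleton

variable {R M : Type*} [CommRing R] [AddCommGroup M] [Module R M]

theorem mem_sup_span_singleton_iff {A : Submodule R M} {x y : M} :
    x ∈ A ⊔ R ∙ y ↔ ∃ r : R, x - r • y ∈ A := by
  rw [Submodule.mem_sup]
  constructor
  · rintro ⟨z, hz, w, hw, rfl⟩
    obtain ⟨r, rfl⟩ := Submodule.mem_span_singleton.1 hw
    exact ⟨r, by simpa using hz⟩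
  · rintro ⟨r, hr⟩
    exact ⟨_, hr, _, Submodule.smul_mem _ r (Submodule.mem_span_singleton_self y), by abel⟩

theorem isPrincipal_span_singleton_sup_of_torsionOf_sup_colon_eq_top {x y : M}
    (h : Ideal.torsionOf R M x ⊔ (R ∙ x).colon {y} = ⊤) : (R ∙ x ⊔ R ∙ y).IsPrincipal := by
  obtain ⟨t, ht, j, hj, htj⟩ := Submodule.mem_sup.1 ((Ideal.eq_top_iff_one _).1 h)
  rw [Ideal.mem_torsionOf_iff] at ht
  obtain ⟨d, hd⟩ := Submodule.mem_span_singleton.1 (Submodule.mem_colon_singleton.1 hj)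
  have hjx : j • (x + t • y) = x := by
    linear_combination (norm := module) htj • x - ht + d • ht - t • hd
  have hx : x ∈ R ∙ (x + t • y) := Submodule.mem_span_singleton.2 ⟨j, hjx⟩
  have hy : (x + t • y) + (d - 1) • x = y := by
    linear_combination (norm := module) htj • y + hd
  refine ⟨x + t • y, le_antisymm (sup_le ?_ ?_) ?_⟩ <;>
    rw [Submodule.span_singleton_le_iff_mem]
  · exact hx
  · simpa only [hy] using Submodule.add_mem _ (Submodule.mem_span_singleton_self (x + t • y))
      (Submodule.smul_mem _ (d - 1) hx)
  · exact Submodule.add_mem_sup (Submodule.mem_span_singleton_self x)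
      (Submodule.smul_mem _ t (Submodule.mem_span_singleton_self y))

theorem fg_colon_singleton_of_finitePresentation_sup {A : Submodule R M} {y : M} (hA : A.FG)
    [Module.FinitePresentation R ↥(A ⊔ R ∙ y)] : (A.colon {y}).FG := by
  let φ := A.subtype.coprod (LinearMap.toSpanSingleton R M y)
  have hrange : LinearMap.range φ = A ⊔ R ∙ y := by
    rw [LinearMap.range_coprod, A.range_subtype, LinearMap.range_toSpanSingleton]
  have hker : (LinearMap.ker φ).map (LinearMap.snd R A R) = A.colon {y} := by
    ext r
    simp only [Submodule.mem_map, LinearMap.mem_ker, Submodule.mem_colon_singleton]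
    constructor
    · rintro ⟨⟨u, r⟩, hu, rfl⟩
      have hneg : r • y = -(u : M) := eq_neg_of_add_eq_zero_right hu
      exact hneg.symm ▸ A.neg_mem u.2
    · exact fun hr => ⟨(-⟨r • y, hr⟩, r), neg_add_cancel _, rfl⟩
  have : Module.Finite R A := .of_fg hA
  have : Module.FinitePresentation R (LinearMap.range φ) := .of_equiv (.ofEq _ _ hrange.symm)
  have hfg := Module.FinitePresentation.fg_ker φ.rangeRestrict φ.surjective_rangeRestrict
  rw [LinearMap.ker_rangeRestrict] at hfg
  exact hker ▸ hfg.map _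

theorem nonempty_linearEquiv_sup_of_disjoint_span_singleton {A : Submodule R M} {z : M} {a : R}
    (hz : Disjoint (R ∙ z) A) (ha : Ideal.torsionOf R M z = Ideal.span {a}) :
    Nonempty (((R ⧸ Ideal.span {a}) × A) ≃ₗ[R] ↥(A ⊔ R ∙ z)) := by
  have hinj : Function.Injective ((R ∙ z).subtype.coprod A.subtype) := by
    rw [← LinearMap.ker_eq_bot, LinearMap.ker_coprod_of_disjoint_range _ _ (by simpa using hz)]
    simp
  have hrange : LinearMap.range ((R ∙ z).subtype.coprod A.subtype) = A ⊔ R ∙ z := by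
    rw [LinearMap.range_coprod, Submodule.range_subtype, Submodule.range_subtype, sup_comm]
  exact ⟨.prodCongr (Submodule.quotEquivOfEq _ _ ha.symm ≪≫ₗ
    Ideal.quotTorsionOfEquivSpanSingleton R M z) (.refl R A) ≪≫ₗ
    .ofInjective _ hinj ≪≫ₗ .ofEq _ _ hrange⟩

end SpanSingleton

section CyclicSeries

variable {R : Type u} [CommRing R] {M : Type u} [AddCommGroup M] [Module R M]

theorem exists_eq_sup_span_singleton_of_isCyclicModule {A B : Submodule R M} (hAB : A ≤ B)
    (h : IsCyclicModule R (↥B ⧸ A.submoduleOf B)) : ∃ y, B = A ⊔ R ∙ y := by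
  obtain ⟨q, hq⟩ := h
  obtain ⟨y, rfl⟩ := Submodule.mkQ_surjective _ q
  refine ⟨y, le_antisymm (fun b hb => ?_) (sup_le hAB ?_)⟩
  · obtain ⟨r, hr⟩ := Submodule.mem_span_singleton.1
      (hq.ge (Submodule.mem_top (x := (A.submoduleOf B).mkQ ⟨b, hb⟩)))
    rw [eq_comm, ← sub_eq_zero, ← map_smul, ← map_sub, Submodule.mkQ_apply,
      Submodule.Quotient.mk_eq_zero] at hr
    exact mem_sup_span_singleton_iff.2 ⟨r, hr⟩
  · exact (Submodule.span_singleton_le_iff_mem _ _).2 y.2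

theorem HasCyclicSeries.mono {Q Q' : Submodule R M → Prop} (hQ : ∀ F, Q F → Q' F)
    (h : HasCyclicSeries Q) : HasCyclicSeries Q' := by
  obtain ⟨n, c, hmono, h0, hlast, hc, hcyc⟩ := h
  exact ⟨n, c, hmono, h0, hlast, fun i => hQ _ (hc i), hcyc⟩

theorem HasCyclicSeries.induction {Q motive : Submodule R M → Prop} (h : HasCyclicSeries Q)
    (bot : motive ⊥) (sup_span : ∀ A y, Q A → motive A → motive (A ⊔ R ∙ y)) : motive ⊤ := by
  obtain ⟨n, c, hmono, h0, hlast, hQ, hcyc⟩ := h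
  rw [← hlast]
  induction Fin.last n using Fin.induction with
  | zero => rwa [h0]
  | succ i ih =>
    obtain ⟨y, hy⟩ := exists_eq_sup_span_singleton_of_isCyclicModule
      (hmono i.castSucc_lt_succ).le (hcyc i)
    rw [hy]
    exact sup_span _ y (hQ _) ih

end CyclicSeries

section IncomparablePair

variable {R : Type*} [CommRing R] {P : Ideal R}

/- Modulo `P` the rank-one matrix `(α, β)ᵀ (x, y)` is the scalar matrix `t`. Its determinant gives
`t² ∈ P`, so its trace `2 t` lies in `P` as well. -/
theorem mul_add_mul_mem_of_scalar_mul_eq [P.IsPrime] {a b α β x y t : R}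
    (hab : ∀ p q, p * a + q * b = 0 → p ∈ P ∧ q ∈ P)
    (hx : (a * α + b * β) * x = t * a) (hy : (a * α + b * β) * y = t * b) :
    α * x + β * y ∈ P := by
  obtain ⟨hαx, hβx⟩ := hab (α * x - t) (β * x) (by linear_combination hx)
  obtain ⟨hαy, hβy⟩ := hab (α * y) (β * y - t) (by linear_combination hy)
  rw [← Ideal.Quotient.eq_zero_iff_mem] at hαx hβx hβy ⊢
  simp only [map_sub, map_mul, map_add, sub_eq_zero] at hαx hβx hβy ⊢
  have ht : Ideal.Quotient.mk P t = 0 := by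
    refine (pow_eq_zero_iff two_ne_zero).1 ?_
    calc Ideal.Quotient.mk P t ^ 2
        = (Ideal.Quotient.mk P α * Ideal.Quotient.mk P x) *
          (Ideal.Quotient.mk P β * Ideal.Quotient.mk P y) := by rw [hαx, hβy, sq]
      _ = (Ideal.Quotient.mk P β * Ideal.Quotient.mk P x) *
          (Ideal.Quotient.mk P α * Ideal.Quotient.mk P y) := by ring
      _ = 0 := by rw [hβx, zero_mul]
  rw [hαx, hβy, ht, add_zero]

theorem colon_bot_quotient_span_singleton_le {a b : R} (ha : a ∈ P) :
    (⊥ : Submodule R ((R × R) ⧸ R ∙ (a, b))).colon Set.univ ≤ P := by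
  intro s hs
  have hse := Submodule.mem_colon.1 hs ((R ∙ (a, b)).mkQ (1, 0)) (Set.mem_univ _)
  rw [Submodule.mem_bot, ← map_smul, Submodule.mkQ_apply, Submodule.Quotient.mk_eq_zero] at hse
  obtain ⟨t, ht⟩ := Submodule.mem_span_singleton.1 hse
  have hta : t * a = s := by simpa using congrArg Prod.fst ht
  exact hta ▸ P.mul_mem_left t ha

end IncomparablePair

section Arithmetic

theorem algebraMap_dvd_algebraMap_iff {R S : Type*} [CommRing R] [CommRing S] [Algebra R S]
    (M : Submonoid R) [IsLocalization M S] {a b : R} :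
    algebraMap R S a ∣ algebraMap R S b ↔ ∃ s ∈ M, a ∣ s * b := by
  constructor
  · rintro ⟨c, hc⟩
    obtain ⟨r, s, rfl⟩ := IsLocalization.exists_mk'_eq M c
    rw [← IsLocalization.mk'_one (M := M) S b, IsLocalization.mul_mk'_eq_mk'_of_mul,
      IsLocalization.eq] at hc
    obtain ⟨t, ht⟩ := hc
    exact ⟨t * s, M.mul_mem t.2 s.2, t * r, by simpa [mul_assoc, mul_left_comm] using ht⟩
  · rintro ⟨s, hs, hdvd⟩
    have := map_dvd (algebraMap R S) hdvd
    rwa [map_mul, (IsLocalization.map_units S ⟨s, hs⟩).dvd_mul_left] at this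

variable {R : Type u} [CommRing R]

theorem isUniserialRing_iff_dvd_total : IsUniserialRing R ↔ ∀ a b : R, a ∣ b ∨ b ∣ a :=
  ⟨fun h => (PreValuationRing.iff_dvd_total.1 (PreValuationRing.iff_ideal_total.2 ⟨h⟩)).total,
    fun h => (PreValuationRing.iff_ideal_total.1 (PreValuationRing.iff_dvd_total.2 ⟨h⟩)).total⟩

theorem isArithmeticRing_iff_forall_exists_dvd_mul : IsArithmeticRing R ↔
    ∀ (P : Ideal R), P.IsMaximal → ∀ a b, ∃ s ∉ P, a ∣ s * b ∨ b ∣ s * a := by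
  refine forall₂_congr fun P hP => ?_
  rw [isUniserialRing_iff_dvd_total]
  have hdvd (a b : R) : algebraMap R (Localization.AtPrime P) a ∣ algebraMap R _ b ↔
      ∃ s ∉ P, a ∣ s * b := algebraMap_dvd_algebraMap_iff P.primeCompl
  constructor
  · intro h a b
    simpa only [hdvd, ← exists_or, ← and_or_left] using h (algebraMap R _ a) (algebraMap R _ b)
  · intro h x y
    obtain ⟨⟨a, s⟩, ha⟩ := IsLocalization.surj P.primeCompl x
    obtain ⟨⟨b, t⟩, hb⟩ := IsLocalization.surj P.primeCompl y
    have hxa : Associated x (algebraMap R _ a) := ⟨(IsLocalization.map_units _ s).unit, ha⟩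
    have hyb : Associated y (algebraMap R _ b) := ⟨(IsLocalization.map_units _ t).unit, hb⟩
    rw [hxa.dvd_iff_dvd_left, hyb.dvd_iff_dvd_right, hyb.dvd_iff_dvd_left, hxa.dvd_iff_dvd_right,
      hdvd, hdvd]
    simpa only [← exists_or, ← and_or_left] using h a b

theorem IsRDSubmodule.exists_mem_sub_smul_mem {P : Ideal R} [P.IsPrime] {a b : R}
    (hab : ∀ p q, p * a + q * b = 0 → p ∈ P ∧ q ∈ P)
    {G : Submodule R ((R × R) ⧸ R ∙ (a, b))} (hG : IsRDSubmodule G)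
    {z : (R × R) ⧸ R ∙ (a, b)} {s α β : R}
    (hα : s • (R ∙ (a, b)).mkQ (1, 0) - α • z ∈ G)
    (hβ : s • (R ∙ (a, b)).mkQ (0, 1) - β • z ∈ G) :
    ∃ c ∈ P, (s - c) • z ∈ G := by
  set π := (R ∙ (a, b)).mkQ with hπ
  have hbasis (x y : R) : π (x, y) = x • π (1, 0) + y • π (0, 1) := by
    rw [← map_smul, ← map_smul, ← map_add]
    simp
  have hker (v : R × R) : π v = 0 ↔ ∃ t : R, t • (a, b) = v := by
    rw [hπ, Submodule.mkQ_apply, Submodule.Quotient.mk_eq_zero, Submodule.mem_span_singleton]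
  have hrel : a • π (1, 0) + b • π (0, 1) = 0 := by
    rw [← hbasis, hker]
    exact ⟨1, one_smul _ _⟩
  have hrz : (a * α + b * β) • z ∈ G := by
    convert G.add_mem (G.smul_mem (-a) hα) (G.smul_mem (-b) hβ) using 1
    linear_combination (norm := module) s • hrel
  obtain ⟨f, hf, hfz⟩ := isRDSubmodule_iff_forall_exists_smul_eq.1 hG _ _ hrz
  obtain ⟨⟨x, y⟩, hxy⟩ := (R ∙ (a, b)).mkQ_surjective (z - f)
  obtain ⟨t, ht⟩ := (hker ((a * α + b * β) • (x, y))).1 <| by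
    rw [map_smul, hxy, smul_sub, hfz, sub_self]
  refine ⟨α * x + β * y, mul_add_mul_mem_of_scalar_mul_eq hab
    (congrArg Prod.fst ht).symm (congrArg Prod.snd ht).symm, ?_⟩
  convert G.add_mem (G.smul_mem s hf) (G.add_mem (G.smul_mem x hα) (G.smul_mem y hβ)) using 1
  linear_combination (norm := module) (-s) • hxy + s • hbasis x y

theorem IsRDSubmodule.colon_sup_span_singleton_le {P : Ideal R} [P.IsPrime] {a b : R}
    (hab : ∀ p q, p * a + q * b = 0 → p ∈ P ∧ q ∈ P)
    {G : Submodule R ((R × R) ⧸ R ∙ (a, b))} (hG : IsRDSubmodule G)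
    (hGP : G.colon Set.univ ≤ P) (z : (R × R) ⧸ R ∙ (a, b)) :
    (G ⊔ R ∙ z).colon Set.univ ≤ P := by
  intro s hs
  simp only [Submodule.mem_colon, Set.mem_univ, true_imp_iff, mem_sup_span_singleton_iff] at hs
  obtain ⟨α, hα⟩ := hs ((R ∙ (a, b)).mkQ (1, 0))
  obtain ⟨β, hβ⟩ := hs ((R ∙ (a, b)).mkQ (0, 1))
  obtain ⟨c, hc, hcz⟩ := hG.exists_mem_sub_smul_mem hab hα hβ
  have hcolon : (s - c) * s ∈ G.colon Set.univ := by
    refine Submodule.mem_colon.2 fun m _ => ?_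
    obtain ⟨γ, hγ⟩ := hs m
    convert G.add_mem (G.smul_mem (s - c) hγ) (G.smul_mem γ hcz) using 1
    module
  rcases ‹P.IsPrime›.mem_or_mem (hGP hcolon) with hsc | hs
  · simpa using P.add_mem hsc hc
  · exact hs

theorem HasRDCyclicSeriesProperty.isArithmeticRing (h : HasRDCyclicSeriesProperty R) :
    IsArithmeticRing R := by
  rw [isArithmeticRing_iff_forall_exists_dvd_mul]
  intro P hP a b
  by_contra! hne
  have hab (p q : R) (hpq : p * a + q * b = 0) : p ∈ P ∧ q ∈ P := by
    constructor <;> by_contra hn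
    · exact (hne p hn).2 ⟨-q, by linear_combination hpq⟩
    · exact (hne q hn).1 ⟨-p, by linear_combination hpq⟩
  have ha : a ∈ P := neg_mem_iff.1 (hab b (-a) (by ring)).2
  have htop := (h ((R × R) ⧸ R ∙ (a, b)) inferInstance).induction
    (motive := fun G => G.colon Set.univ ≤ P) (colon_bot_quotient_span_singleton_le ha)
    fun G z hG hGP => hG.colon_sup_span_singleton_le hab hGP z
  rw [Submodule.top_colon, top_le_iff] at htop
  exact hP.ne_top htop

end Arithmetic

section Bezout

variable {R : Type u} [CommRing R]

theorem IsRDSubmodule.torsionOf_sup_colon_eq_top {E : Type u} [AddCommGroup E] [Module R E]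
    {x y : E} (hx : IsRDSubmodule (R ∙ x))
    (hxy : ∀ P : Ideal R, P.IsMaximal → ∃ s ∉ P, s • x ∈ R ∙ y ∨ s • y ∈ R ∙ x) :
    Ideal.torsionOf R E x ⊔ (R ∙ x).colon {y} = ⊤ := by
  by_contra hne
  obtain ⟨P, hP, hle⟩ := Ideal.exists_le_maximal _ hne
  obtain ⟨htors, hcolon⟩ := sup_le_iff.1 hle
  obtain ⟨s, hs, hsx | hsy⟩ := hxy P hP
  · obtain ⟨r, hr⟩ := Submodule.mem_span_singleton.1 hsx
    have hrx : r • y ∈ R ∙ x := hr ▸ Submodule.smul_mem _ s (Submodule.mem_span_singleton_self x)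
    obtain ⟨f, hf, hfr⟩ := isRDSubmodule_iff_forall_exists_smul_eq.1 hx r y hrx
    obtain ⟨d, rfl⟩ := Submodule.mem_span_singleton.1 hf
    have hsrd : s - r * d ∈ P := htors <| by
      rw [Ideal.mem_torsionOf_iff, sub_smul, ← hr, mul_smul, hfr, sub_self]
    have hrd : r * d ∈ P := P.mul_mem_right d (hcolon (Submodule.mem_colon_singleton.2 hrx))
    exact hs (by simpa using P.add_mem hsrd hrd)
  · exact hs (hcolon (Submodule.mem_colon_singleton.2 hsy))

theorem HasRDCyclicSeriesProperty.isBezout (h : HasRDCyclicSeriesProperty R) : IsBezout R := by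
  have hR := isArithmeticRing_iff_forall_exists_dvd_mul.1 h.isArithmeticRing
  refine ⟨fun I hI => ?_⟩
  have htop : (⊤ : Submodule R I).IsPrincipal :=
    (h I (Module.Finite.iff_fg.2 hI)).induction bot_isPrincipal fun A y hA hprin => by
      obtain ⟨x, rfl⟩ := hprin
      refine isPrincipal_span_singleton_sup_of_torsionOf_sup_colon_eq_top
        (hA.torsionOf_sup_colon_eq_top fun P hP => ?_)
      obtain ⟨s, hs, hdvd⟩ := hR P hP (y : R) (x : R)
      have hspan (v w : I) (hvw : (v : R) ∣ s * w) : s • w ∈ R ∙ v := by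
        obtain ⟨r, hr⟩ := hvw
        exact Submodule.mem_span_singleton.2 ⟨r, Subtype.ext (by simp [hr, mul_comm])⟩
      exact ⟨s, hs, hdvd.imp (hspan y x) (hspan x y)⟩
  simpa using htop.map I.subtype

end Bezout

section SumOfCyclicallyPresented

variable {R M : Type*} [CommRing R] [AddCommGroup M] [Module R M]

/-- `M` is a finite direct sum of cyclically presented modules `R ⧸ Ra`, the conclusion of
`IsKaplanskyRing` for a single module. -/
def IsSumOfCyclicallyPresented (R M : Type*) [CommRing R] [AddCommGroup M] [Module R M] : Prop :=
  ∃ (n : ℕ) (a : Fin n → R), Nonempty (M ≃ₗ[R] ((i : Fin n) → R ⧸ Ideal.span {a i}))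

theorem IsSumOfCyclicallyPresented.of_equiv {M' : Type*} [AddCommGroup M'] [Module R M']
    (h : IsSumOfCyclicallyPresented R M) (e : M ≃ₗ[R] M') : IsSumOfCyclicallyPresented R M' := by
  obtain ⟨n, a, ⟨e'⟩⟩ := h
  exact ⟨n, a, ⟨e.symm ≪≫ₗ e'⟩⟩

theorem isSumOfCyclicallyPresented_of_subsingleton [Subsingleton M] :
    IsSumOfCyclicallyPresented R M :=
  ⟨0, Fin.elim0, ⟨0, 0, fun _ => Subsingleton.elim _ _, fun _ => Subsingleton.elim _ _⟩⟩

theorem IsSumOfCyclicallyPresented.quotient_prod (h : IsSumOfCyclicallyPresented R M) (a : R) :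
    IsSumOfCyclicallyPresented R ((R ⧸ Ideal.span {a}) × M) := by
  obtain ⟨n, b, ⟨e⟩⟩ := h
  exact ⟨n + 1, Fin.cons a b, ⟨.prodCongr (.refl R _) e ≪≫ₗ
    Fin.consLinearEquiv R fun i => R ⧸ Ideal.span {(Fin.cons a b : Fin (n + 1) → R) i}⟩⟩

end SumOfCyclicallyPresented

section Kaplansky

variable {R : Type u} [CommRing R] {M : Type u} [AddCommGroup M] [Module R M]

theorem IsRDSubmodule.exists_disjoint_span_singleton {A : Submodule R M} (hA : IsRDSubmodule A)
    {y : M} {a : R} (ha : A.colon {y} = Ideal.span {a}) :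
    ∃ z, A ⊔ R ∙ z = A ⊔ R ∙ y ∧ Disjoint (R ∙ z) A ∧
      Ideal.torsionOf R M z = Ideal.span {a} := by
  have hay : a • y ∈ A :=
    Submodule.mem_colon_singleton.1 (ha.ge (Ideal.mem_span_singleton_self a))
  obtain ⟨f, hf, hfa⟩ := isRDSubmodule_iff_forall_exists_smul_eq.1 hA a y hay
  have hmem (r : R) (hr : r • (y - f) ∈ A) : r ∈ Ideal.span {a} := by
    rw [← ha, Submodule.mem_colon_singleton]
    simpa [smul_sub] using A.add_mem hr (A.smul_mem r hf)
  have hzero (r : R) (hr : r ∈ Ideal.span {a}) : r • (y - f) = 0 := by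
    obtain ⟨d, rfl⟩ := Ideal.mem_span_singleton'.1 hr
    rw [mul_smul, smul_sub, hfa, sub_self, smul_zero]
  refine ⟨y - f, ?_, ?_, ?_⟩
  · ext m
    simp only [mem_sup_span_singleton_iff]
    refine exists_congr fun r => ?_
    rw [smul_sub, sub_sub_eq_add_sub, add_sub_right_comm]
    exact A.add_mem_iff_left (A.smul_mem r hf)
  · rw [Submodule.disjoint_def]
    intro m hm hmA
    obtain ⟨r, rfl⟩ := Submodule.mem_span_singleton.1 hm
    exact hzero r (hmem r hmA)
  · ext r
    rw [Ideal.mem_torsionOf_iff]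
    exact ⟨fun hr => hmem r (hr ▸ A.zero_mem), hzero r⟩

theorem IsRDSubmodule.isSumOfCyclicallyPresented_sup [IsBezout R] {A : Submodule R M} {y : M}
    (hA : IsRDSubmodule A) (hfg : A.FG) [Module.FinitePresentation R ↥(A ⊔ R ∙ y)]
    (hsum : Module.FinitePresentation R A → IsSumOfCyclicallyPresented R A) :
    IsSumOfCyclicallyPresented R ↥(A ⊔ R ∙ y) := by
  obtain ⟨a, ha⟩ := IsBezout.isPrincipal_of_FG _
    (fg_colon_singleton_of_finitePresentation_sup (y := y) hfg)
  obtain ⟨z, hz, hdisj, htors⟩ := hA.exists_disjoint_span_singleton ha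
  obtain ⟨e⟩ := nonempty_linearEquiv_sup_of_disjoint_span_singleton hdisj htors
  have : Module.FinitePresentation R ↥(A ⊔ R ∙ z) := by rwa [hz]
  have : Module.FinitePresentation R ((R ⧸ Ideal.span {a}) × A) := .of_equiv e.symm
  have hfp : Module.FinitePresentation R A :=
    Module.finitePresentation_of_split_exact (LinearMap.inr R (R ⧸ Ideal.span {a}) A)
      (LinearMap.fst R _ _) (LinearMap.inl R _ _) (LinearMap.fst_comp_inl _ _ _)
      LinearMap.inr_injective .inr_fst
  exact hz ▸ ((hsum hfp).quotient_prod a).of_equiv e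

theorem HasRDCyclicSeriesProperty.isKaplanskyRing (h : HasRDCyclicSeriesProperty R) :
    IsKaplanskyRing R := by
  intro M _ _ hM
  have := h.isBezout
  have htop : (⊤ : Submodule R M).FG ∧ (Module.FinitePresentation R (⊤ : Submodule R M) →
      IsSumOfCyclicallyPresented R (⊤ : Submodule R M)) :=
    (h M inferInstance).induction
      (motive := fun A => A.FG ∧ (Module.FinitePresentation R A → IsSumOfCyclicallyPresented R A))
      ⟨Submodule.fg_bot, fun _ => isSumOfCyclicallyPresented_of_subsingleton⟩
      fun A y hA ⟨hfg, hsum⟩ => ⟨hfg.sup (Submodule.fg_span_singleton y),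
        fun _ => hA.isSumOfCyclicallyPresented_sup hfg hsum⟩
  exact (htop.2 (.of_equiv Submodule.topEquiv.symm)).of_equiv Submodule.topEquiv

end Kaplansky

theorem mainTheorem5 (R : Type u) [CommRing R] :
    (HasPureCyclicSeriesProperty R ↔ HasRDCyclicSeriesProperty R) ∧
    (HasPureCyclicSeriesProperty R ∨ HasRDCyclicSeriesProperty R →
      IsArithmeticRing R ∧ IsKaplanskyRing R) := by
  have hiff : HasPureCyclicSeriesProperty R ↔ HasRDCyclicSeriesProperty R :=
    ⟨fun h M _ _ hM => (h M hM).mono fun _ hF => hF.isRDSubmodule, fun h M _ _ hM =>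
      (h M hM).mono fun _ hF => h.isKaplanskyRing.isPureSubmodule_of_isRDSubmodule hF⟩
  refine ⟨hiff, fun h => ?_⟩
  have hRD : HasRDCyclicSeriesProperty R := h.elim hiff.1 id
  exact ⟨hRD.isArithmeticRing, hRD.isKaplanskyRing⟩
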